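/- For each $n\ge 1$ let $X_1,\dots,X_n,Y_1,\dots,Y_n$ be independent unit-exponential random variables (on a probability space with probability measure $P_n$ that may depend on $n$), and let $X_{(1)}\le\dots\le X_{(n)}$ and $Y_{(1)}\le\dots\le Y_{(n)}$ be the order statistics of the two samples. Then for every fixed integer $\ell\ge 1$ the maximum ranked quotient $\max_{1\le i\le \ell} X_{(i)}/Y_{(i)}$ (defined for $n\ge\ell$) converges weakly, as $n\to\infty$, to a non-degenerate probability distribution on $\mathbb{R}$ (one that is not a point mass). Its cumulative distribution function $R_\ell$ satisfies $$R_\ell(t)=\lim_{n\to\infty}P_n\Big(\max_{1\le i\le \ell}\frac{X_{(i)}}{Y_{(i)}}\le t\Big)\quad\text{for every } t\in\mathbb{R},$$ and is given by $$R_\ell(t)=\frac{\sum_{j=0}^{\ell-1}(-1)^j\,B_{\ell-1,j}\,k^{\ell-j-1}}{k^{2\ell-1}},\qquad k=1+\frac1t,\qquad t>0,$$ and $R_\ell(t)=0$ for $t\le 0$, where $$B_{m,j}=\frac{1}{m+1}\binom{2m+2}{m-j}\binom{m+j}{m},\qquad 0\le j\le m,$$ are the entries of the Borel triangle. -/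

import Mathlib

open MeasureTheory ProbabilityTheory Filter Topology

noncomputable section

/-- The order statistics of a finite real sample: `orderStat x i` is the `(i + 1)`-st smallest
entry of `x`, counted with multiplicity (indices in `Fin n` start at `0`). -/
def orderStat {n : ℕ} (x : Fin n → ℝ) : Fin n → ℝ :=
  x ∘ Tuple.sort x

/-- The maximum ranked quotient `max_{i ∈ Λ} x_(i) / y_(i)` of two samples of size `n` on the index
set `Λ` (with the value `0` on the empty index set). -/
def maxRankedQuotient {n : ℕ} (Λ : Finset (Fin n)) (x y : Fin n → ℝ) : ℝ :=
  if h : Λ.Nonempty then Λ.sup' h (fun i => orderStat x i / orderStat y i) else 0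

/-- The ranks `1, …, ℓ` in a sample of size `n`; for `n < ℓ` these are all the ranks. -/
def leftIndices (n ℓ : ℕ) : Finset (Fin n) :=
  Finset.univ.filter (fun i => (i : ℕ) < ℓ)

/-- The entry `B_{m,j}`, `0 ≤ j ≤ m`, of the Borel triangle. -/
def borelTriangle (m j : ℕ) : ℝ :=
  ((2 * m + 2).choose (m - j) : ℝ) * ((m + j).choose m : ℝ) / ((m : ℝ) + 1)

/-- The rational expression in `k` that gives the limiting distribution function, for `1 ≤ ℓ`. -/
def leftLimitExpr (ℓ : ℕ) (k : ℝ) : ℝ :=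
  (∑ j ∈ Finset.range ℓ, (-1) ^ j * (borelTriangle (ℓ - 1) j * k ^ (ℓ - j - 1))) / k ^ (2 * ℓ - 1)

/-- The limiting distribution function on the real line: the expression at `k = 1 + 1 / t` for
`t > 0`. At `t = 0`, where `k = ∞`, it is read as its limit `0`, and it vanishes for `t < 0`. -/
def leftLimitCDF (ℓ : ℕ) (t : ℝ) : ℝ :=
  if 0 < t then leftLimitExpr ℓ (1 + 1 / t) else 0

end

/-! For `t > 0` the event says `X_(i) ≤ t Y_(i)` for all `i ≤ ℓ`. Pool the `X_i` (heads, rate `1`)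
with the `t Y_i` (tails, rate `κ = 1/t`) and read them in increasing order: the event says that
tails never outnumber heads until the `ℓ`-th head has appeared
(`forall_orderStat_le_iff_headsLead`). By competing exponentials and lack of memory, the next point
is a head with probability `n / (n + κ m)` when `n` heads and `m` tails remain, and the rest starts
afresh. So the probability for finite `n` is exactly the urn recursion (`measureReal_headsLead`).

As `n → ∞` with `ℓ` fixed the weights tend to `p = 1/(1 + κ) = 1/k` and `1 - p`, and the urn becomes
a coin race (`tendsto_urnRace`). Sorting its successful outcomes by the number `j` of tails gives `p
^ ℓ` times a sum of ballot numbers against `(1 - p) ^ j` (`coinRace_eq_sum`). Expanding in powers of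
`p` produces the Borel triangle (`sum_ballotCount_eq_sum_borelTriangle`).

The limit is continuous in `t` and runs from `0` to `1`, so it is the distribution function of an
atomless law, and pointwise convergence gives weak convergence. -/

/-! ### Race recursions and the passage from urn to coin -/

/-- The probability that, in a coin tossing sequence with weights `p` for heads and `q` for tails
started with `d` heads in advance, `a` further heads appear before the tails outnumber
the heads. -/
noncomputable def coinRace (p q : ℝ) : ℕ → ℕ → ℝ
  | 0, _ => 1
  | a + 1, 0 => p * coinRace p q a 1
  | a + 1, d + 1 => p * coinRace p q a (d + 2) + q * coinRace p q (a + 1) d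
termination_by a d => 2 * a + d

/-- The analogue of `coinRace` for drawing without replacement from an urn with `n` heads of
weight `1` and `m` tails of weight `κ`. -/
noncomputable def urnRace (κ : ℝ) : ℕ → ℕ → ℕ → ℕ → ℝ
  | 0, _, _, _ => 1
  | a + 1, 0, n, m => n / (n + κ * m) * urnRace κ a 1 (n - 1) m
  | a + 1, d + 1, n, m => n / (n + κ * m) * urnRace κ a (d + 2) (n - 1) m +
      κ * m / (n + κ * m) * urnRace κ (a + 1) d n (m - 1)
termination_by a d => 2 * a + d

lemma tendsto_natCast_sub_div_atTop (i : ℕ) :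
    Tendsto (fun n : ℕ => ((n - i : ℕ) : ℝ) / n) atTop (𝓝 1) := by
  have h : Tendsto (fun n : ℕ => 1 - (i : ℝ) / n) atTop (𝓝 (1 - 0)) :=
    tendsto_const_nhds.sub (tendsto_const_div_atTop_nhds_zero_nat (i : ℝ))
  rw [sub_zero] at h
  refine h.congr' ?_
  filter_upwards [eventually_ge_atTop (i + 1)] with n hn
  have : (n : ℝ) ≠ 0 := by norm_cast; omega
  rw [Nat.cast_sub (by omega)]
  field_simp

lemma tendsto_head_weight {κ : ℝ} (hκ : 0 < κ) (i j : ℕ) :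
    Tendsto (fun n : ℕ => ((n - i : ℕ) : ℝ) / ((n - i : ℕ) + κ * (n - j : ℕ))) atTop
      (𝓝 (1 / (1 + κ))) := by
  have h := (tendsto_natCast_sub_div_atTop i).div
    ((tendsto_natCast_sub_div_atTop i).add ((tendsto_natCast_sub_div_atTop j).const_mul κ))
    (by positivity)
  rw [mul_one] at h
  refine h.congr' ?_
  filter_upwards [eventually_gt_atTop 0] with n hn
  have : (n : ℝ) ≠ 0 := by positivity
  simp only [Pi.div_apply]
  rw [← mul_div_assoc, ← add_div, div_div_div_cancel_right₀ this]

lemma tendsto_tail_weight {κ : ℝ} (hκ : 0 < κ) (i j : ℕ) :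
    Tendsto (fun n : ℕ => κ * ((n - j : ℕ) : ℝ) / ((n - i : ℕ) + κ * (n - j : ℕ))) atTop
      (𝓝 (κ / (1 + κ))) := by
  have h := ((tendsto_natCast_sub_div_atTop j).const_mul κ).div
    ((tendsto_natCast_sub_div_atTop i).add ((tendsto_natCast_sub_div_atTop j).const_mul κ))
    (by positivity)
  rw [mul_one] at h
  refine h.congr' ?_
  filter_upwards [eventually_gt_atTop 0] with n hn
  have : (n : ℝ) ≠ 0 := by positivity
  simp only [Pi.div_apply]
  rw [← mul_div_assoc, ← add_div, div_div_div_cancel_right₀ this]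

/-- The offsets `i`, `j` are general because each draw removes a ball. Both kinds of draw lower `2 *
a + d`, so only finitely many weights enter and the limit passes through the recursion. -/
lemma tendsto_urnRace {κ : ℝ} (hκ : 0 < κ) (a d i j : ℕ) :
    Tendsto (fun n : ℕ => urnRace κ a d (n - i) (n - j)) atTop
      (𝓝 (coinRace (1 / (1 + κ)) (κ / (1 + κ)) a d)) := by
  induction h : 2 * a + d using Nat.strong_induction_on generalizing a d i j with
  | _ N ih =>
    subst h
    match a, d with
    | 0, d => simpa only [urnRace, coinRace] using tendsto_const_nhds
    | a + 1, 0 =>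
      simp only [urnRace, coinRace, Nat.sub_sub]
      exact (tendsto_head_weight hκ i j).mul (ih _ (by omega) a 1 (i + 1) j rfl)
    | a + 1, d + 1 =>
      simp only [urnRace, coinRace, Nat.sub_sub]
      exact ((tendsto_head_weight hκ i j).mul (ih _ (by omega) a (d + 2) (i + 1) j rfl)).add
        ((tendsto_tail_weight hκ i j).mul (ih _ (by omega) (a + 1) d i (j + 1) rfl))

/-! ### Ballot numbers and the Borel triangle -/

/-- The number of sequences of `a` heads and `j` tails that end with a head and in which, after
`d` heads in advance, tails never outnumber heads. -/
noncomputable def ballotCount (a d j : ℕ) : ℝ :=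
  (a + j - 1).choose j - if d < j then ((a + j - 1).choose (j - d - 1) : ℝ) else 0

lemma ballotCount_zero_right (a d : ℕ) : ballotCount a d 0 = 1 := by simp [ballotCount]

/-- With no advance the first toss must be a head. Algebraically, Pascal's rule on both binomials
makes the middle terms cancel. -/
lemma ballotCount_succ_zero (a j : ℕ) : ballotCount (a + 1) 0 j = ballotCount a 1 j := by
  match j with
  | 0 => simp [ballotCount]
  | 1 => simp [ballotCount]
  | j + 2 =>
    simp only [ballotCount]
    rw [if_pos (by omega), if_pos (by omega),
      show a + 1 + (j + 2) - 1 = (a + j + 1) + 1 by omega, show a + (j + 2) - 1 = a + j + 1 by omega,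
      show j + 2 - 0 - 1 = j + 1 by omega, show j + 2 - 1 - 1 = j by omega,
      Nat.choose_succ_succ (a + j + 1) (j + 1), Nat.choose_succ_succ (a + j + 1) j]
    push_cast
    ring

/-- Decomposition by the first toss. It is Pascal's rule for the main and the reflected binomial;
the case `j = d + 1` is where the reflected term first appears. -/
lemma ballotCount_succ_succ_succ (a d j : ℕ) :
    ballotCount (a + 1) (d + 1) (j + 1) =
      ballotCount a (d + 2) (j + 1) + ballotCount (a + 1) d j := by
  simp only [ballotCount]
  rw [show a + 1 + (j + 1) - 1 = (a + j) + 1 by omega, show a + (j + 1) - 1 = a + j by omega,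
    show a + 1 + j - 1 = a + j by omega, Nat.choose_succ_succ]
  rcases lt_trichotomy j (d + 1) with h | h | h
  · rw [if_neg (by omega), if_neg (by omega), if_neg (by omega)]
    push_cast
    ring
  · subst h
    simp
    ring
  · obtain ⟨k, rfl⟩ := Nat.exists_eq_add_of_lt h
    rw [if_pos (by omega), if_pos (by omega), if_pos (by omega),
      show d + 1 + k + 1 + 1 - (d + 1) - 1 = k + 1 by omega,
      show d + 1 + k + 1 + 1 - (d + 2) - 1 = k by omega,
      show d + 1 + k + 1 - d - 1 = k + 1 by omega, Nat.choose_succ_succ _ k]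
    push_cast
    ring

/-- The ballot numbers obey the recursion of the race. Just before the last head there are at most
`a - 1 + d` tails, hence the range; for `a = d = 0` it would be empty although the race is won. -/
lemma coinRace_eq_sum (q : ℝ) (a d : ℕ) (h : 1 ≤ a + d) :
    coinRace (1 - q) q a d =
      (1 - q) ^ a * ∑ j ∈ Finset.range (a + d), ballotCount a d j * q ^ j := by
  induction hN : 2 * a + d using Nat.strong_induction_on generalizing a d with
  | _ N ih =>
    subst hN
    match a, d with
    | 0, d + 1 =>
      rw [zero_add, Finset.sum_range_succ', Finset.sum_eq_zero]
      · simp [coinRace, ballotCount]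
      · intro j hj
        have : ¬ d + 1 < j + 1 := by simp at hj; omega
        simp [ballotCount, this]
    | a + 1, 0 =>
      rw [coinRace, ih _ (by omega) a 1 (by omega) rfl]
      simp only [ballotCount_succ_zero]
      ring
    | a + 1, d + 1 =>
      rw [coinRace, ih _ (by omega) a (d + 2) (by omega) rfl,
        ih _ (by omega) (a + 1) d (by omega) rfl,
        show a + 1 + (d + 1) = (a + d + 1) + 1 by omega,
        show a + (d + 2) = (a + d + 1) + 1 by omega, show a + 1 + d = a + d + 1 by omega,
        Finset.sum_range_succ' (fun j => ballotCount (a + 1) (d + 1) j * q ^ j),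
        Finset.sum_range_succ' (fun j => ballotCount a (d + 2) j * q ^ j)]
      simp only [ballotCount_succ_succ_succ, ballotCount_zero_right, add_mul,
        Finset.sum_add_distrib, pow_succ, ← mul_assoc, ← Finset.sum_mul]
      ring

lemma succ_mul_ballotCount (m j : ℕ) :
    (m + 1) * ballotCount (m + 1) 0 j = (m + 1 - j) * (m + j).choose j := by
  match j with
  | 0 => simp [ballotCount]
  | j + 1 =>
    have h : ((m + (j + 1)).choose (j + 1) : ℝ) * (j + 1) =
        (m + (j + 1)).choose j * (m + 1) := by
      have := Nat.choose_succ_right_eq (m + (j + 1)) j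
      rw [show m + (j + 1) - j = m + 1 by omega] at this
      exact_mod_cast this
    simp only [ballotCount]
    rw [if_pos (by omega), show m + 1 + (j + 1) - 1 = m + (j + 1) by omega,
      show j + 1 - 0 - 1 = j by omega]
    push_cast
    linear_combination h

lemma sum_range_choose_add (m i b : ℕ) :
    ∑ j ∈ Finset.range b, (m + j).choose (m + i) = (m + b).choose (m + i + 1) := by
  induction b with
  | zero => simp [Nat.choose_eq_zero_of_lt]
  | succ b ih =>
    rw [Finset.sum_range_succ, ih, ← add_assoc m b 1, Nat.choose_succ_succ, add_comm]

/-- The weight `b - j` counts partial sums, so this is the hockey-stick identity applied twice. -/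
lemma sum_range_sub_mul_choose_add (m i b : ℕ) :
    ∑ j ∈ Finset.range b, ((b : ℝ) - j) * (m + j).choose (m + i) =
      (m + b + 1).choose (m + i + 2) := by
  induction b with
  | zero => simp [Nat.choose_eq_zero_of_lt]
  | succ b ih =>
    have h : ∑ j ∈ Finset.range (b + 1), (((b + 1 : ℕ) : ℝ) - j) * (m + j).choose (m + i) =
        ∑ j ∈ Finset.range (b + 1), ((b : ℝ) - j) * (m + j).choose (m + i) +
          ((∑ j ∈ Finset.range (b + 1), (m + j).choose (m + i) : ℕ) : ℝ) := by
      push_cast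
      rw [← Finset.sum_add_distrib]
      exact Finset.sum_congr rfl fun j _ => by ring
    rw [h, sum_range_choose_add, Finset.sum_range_succ, ih, ← add_assoc m b 1,
      Nat.choose_succ_succ (m + b + 1)]
    push_cast
    ring

/-- Both sides are the trinomial coefficient `(m + j)! / (m! i! (j - i)!)`, or zero when `i > j`. -/
lemma choose_mul_choose_add (m j i : ℕ) :
    (m + j).choose j * j.choose i = (m + j).choose (m + i) * (m + i).choose m := by
  rcases le_or_gt i j with h | h
  · rw [Nat.choose_mul h, Nat.choose_symm_add (a := m) (b := i),
      Nat.choose_mul (Nat.le_add_left i m), show m + i - i = m by omega,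
      Nat.choose_symm_of_eq_add (n := m + j - i) (a := j - i) (b := m) (by omega)]
  · rw [Nat.choose_eq_zero_of_lt h, Nat.choose_eq_zero_of_lt (by omega : m + j < m + i)]
    simp

lemma sum_ballotCount_eq_sum_borelTriangle (m : ℕ) (p : ℝ) :
    ∑ j ∈ Finset.range (m + 1), ballotCount (m + 1) 0 j * (1 - p) ^ j =
      ∑ i ∈ Finset.range (m + 1), (-1) ^ i * (borelTriangle m i * p ^ i) := by
  have hm : (m : ℝ) + 1 ≠ 0 := by positivity
  have hexp (j : ℕ) (hj : j ∈ Finset.range (m + 1)) :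
      (1 - p) ^ j = ∑ i ∈ Finset.range (m + 1), (j.choose i : ℝ) * (-p) ^ i := by
    rw [sub_eq_neg_add, add_pow]
    simp only [one_pow, mul_one]
    rw [Finset.sum_subset (Finset.range_mono (show j + 1 ≤ m + 1 by simpa using hj))]
    · exact Finset.sum_congr rfl fun i _ => mul_comm _ _
    · intro i _ hi
      rw [Nat.choose_eq_zero_of_lt (by simpa using hi)]
      simp
  apply mul_left_cancel₀ hm
  calc (m + 1 : ℝ) * ∑ j ∈ Finset.range (m + 1), ballotCount (m + 1) 0 j * (1 - p) ^ j
      = ∑ j ∈ Finset.range (m + 1), ∑ i ∈ Finset.range (m + 1),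
          (((m + 1 : ℕ) : ℝ) - j) * (m + j).choose (m + i) * ((m + i).choose m * (-p) ^ i) := by
        rw [Finset.mul_sum]
        refine Finset.sum_congr rfl fun j hj => ?_
        rw [hexp j hj, ← mul_assoc, succ_mul_ballotCount, Finset.mul_sum]
        refine Finset.sum_congr rfl fun i _ => ?_
        have : ((m + j).choose j : ℝ) * j.choose i = (m + j).choose (m + i) * (m + i).choose m := by
          exact_mod_cast choose_mul_choose_add m j i
        push_cast
        linear_combination ((m : ℝ) + 1 - j) * (-p) ^ i * this
    _ = ∑ i ∈ Finset.range (m + 1),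
          ((2 * m + 2).choose (m - i) : ℝ) * ((m + i).choose m * (-p) ^ i) := by
        -- After the exchange, the sum over `j` is a double hockey stick with `b = m + 1`, equal to
        -- `C(2m + 2, m + i + 2) = C(2m + 2, m - i)`.
        rw [Finset.sum_comm]
        refine Finset.sum_congr rfl fun i hi => ?_
        have hi : i ≤ m := by simpa [Nat.lt_succ_iff] using hi
        rw [← Finset.sum_mul, sum_range_sub_mul_choose_add,
          Nat.choose_symm_of_eq_add (n := m + (m + 1) + 1) (a := m + i + 2) (b := m - i) (by omega),
          show m + (m + 1) + 1 = 2 * m + 2 by omega]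
    _ = _ := by
        rw [Finset.mul_sum]
        refine Finset.sum_congr rfl fun i _ => ?_
        rw [borelTriangle, neg_pow p]
        field_simp

lemma leftLimitExpr_eq_coinRace {ℓ : ℕ} (hℓ : 1 ≤ ℓ) {k : ℝ} (hk : k ≠ 0) :
    leftLimitExpr ℓ k = coinRace (1 / k) (1 - 1 / k) ℓ 0 := by
  obtain ⟨m, rfl⟩ := Nat.exists_eq_add_of_le' hℓ
  have h := coinRace_eq_sum (1 - 1 / k) (m + 1) 0 (by omega)
  rw [sub_sub_cancel, add_zero, sum_ballotCount_eq_sum_borelTriangle] at h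
  rw [h, leftLimitExpr, Finset.sum_div, Finset.mul_sum]
  refine Finset.sum_congr rfl fun j hj => ?_
  have hj : j ≤ m := by simpa [Nat.lt_succ_iff] using hj
  have e : k ^ (2 * (m + 1) - 1) = k ^ (m + 1 - j - 1) * k ^ (m + 1) * k ^ j := by
    rw [← pow_add, ← pow_add]; congr 1; omega
  rw [e, add_tsub_cancel_right, one_div, inv_pow, inv_pow]
  field_simp

/-! ### Dependence of the coin race on the weight of heads -/

lemma continuous_coinRace (a d : ℕ) : Continuous fun p : ℝ => coinRace p (1 - p) a d := by
  induction h : 2 * a + d using Nat.strong_induction_on generalizing a d with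
  | _ N ih =>
    subst h
    match a, d with
    | 0, d => simpa only [coinRace] using continuous_const
    | a + 1, 0 =>
      simp only [coinRace]
      exact continuous_id.mul (ih _ (by omega) a 1 rfl)
    | a + 1, d + 1 =>
      simp only [coinRace]
      exact (continuous_id.mul (ih _ (by omega) a (d + 2) rfl)).add
        ((continuous_const.sub continuous_id).mul (ih _ (by omega) (a + 1) d rfl))

lemma coinRace_zero_one (a : ℕ) : coinRace 0 1 (a + 1) 0 = 0 := by
  simp [coinRace]

lemma coinRace_one_zero (a d : ℕ) : coinRace 1 0 a d = 1 := by
  induction a generalizing d with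
  | zero => simp [coinRace]
  | succ a ih => cases d <;> simp [coinRace, ih]

/-! ### Removing the first point of the pooled sample -/

/-- In the pooled sample `z` on `S`, where `b` marks the heads, the heads with `d` units in
advance are not outnumbered by the tails until `a` heads have appeared. -/
def HeadsLead {ι : Type*} (b : ι → Bool) (a d : ℕ) (S : Finset ι) (z : ι → ℝ) : Prop :=
  ∀ j ∈ S, (S.filter fun i => b i = false ∧ z i ≤ z j).card ≤
      (S.filter fun i => b i = true ∧ z i ≤ z j).card + d ∨
    a ≤ (S.filter fun i => b i = true ∧ z i ≤ z j).card

section HeadsLead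

variable {ι : Type*} {b : ι → Bool}

lemma headsLead_zero (d : ℕ) (S : Finset ι) (z : ι → ℝ) : HeadsLead b 0 d S z :=
  fun _ _ => Or.inr (Nat.zero_le _)

lemma headsLead_congr {a d : ℕ} {S : Finset ι} {z w : ι → ℝ} (h : ∀ i ∈ S, z i = w i) :
    HeadsLead b a d S z ↔ HeadsLead b a d S w := by
  have hc (c : Bool) (j : ι) (hj : j ∈ S) : S.filter (fun i => b i = c ∧ z i ≤ z j) =
      S.filter (fun i => b i = c ∧ w i ≤ w j) :=
    Finset.filter_congr fun i hi => by rw [h i hi, h j hj]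
  refine forall₂_congr fun j hj => ?_
  rw [hc true j hj, hc false j hj]

lemma measurable_card_filter (S : Finset ι) (c : Bool) (j : ι) :
    Measurable fun z : ι → ℝ => (S.filter fun i => b i = c ∧ z i ≤ z j).card := by
  simp only [Finset.card_filter]
  refine Finset.measurable_sum _ fun i _ => Measurable.ite ?_ measurable_const measurable_const
  exact (MeasurableSet.const _).inter
    (measurableSet_le (measurable_pi_apply i) (measurable_pi_apply j))

lemma measurableSet_headsLead (a d : ℕ) (S : Finset ι) :
    MeasurableSet {z : ι → ℝ | HeadsLead b a d S z} := by
  have : {z : ι → ℝ | HeadsLead b a d S z} = ⋂ j ∈ S,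
      ({z | (S.filter fun i => b i = false ∧ z i ≤ z j).card ≤
          (S.filter fun i => b i = true ∧ z i ≤ z j).card + d} ∪
        {z | a ≤ (S.filter fun i => b i = true ∧ z i ≤ z j).card}) := by
    ext z; simp [HeadsLead]
  rw [this]
  refine Finset.measurableSet_biInter _ fun j _ => MeasurableSet.union ?_ ?_
  · exact measurableSet_le (measurable_card_filter S false j)
      ((measurable_card_filter S true j).add_const d)
  · exact measurableSet_le measurable_const (measurable_card_filter S true j)

variable [DecidableEq ι] {S : Finset ι} {z : ι → ℝ} {i : ι}

lemma card_filter_le_of_isMin (hi : i ∈ S) (hmin : ∀ j ∈ S.erase i, z i < z j) (c : Bool)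
    {j : ι} (hj : j ∈ S.erase i) :
    (S.filter fun l => b l = c ∧ z l ≤ z j).card =
      ((S.erase i).filter fun l => b l = c ∧ z l ≤ z j).card + if b i = c then 1 else 0 := by
  conv_lhs => rw [← Finset.insert_erase hi, Finset.filter_insert]
  have := (hmin j hj).le
  by_cases hc : b i = c
  · rw [if_pos ⟨hc, this⟩, if_pos hc, Finset.card_insert_of_notMem (by simp)]
  · rw [if_neg (fun h => hc h.1), if_neg hc, add_zero]

lemma card_filter_le_min (hi : i ∈ S) (hmin : ∀ j ∈ S.erase i, z i < z j) (c : Bool) :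
    (S.filter fun l => b l = c ∧ z l ≤ z i).card = if b i = c then 1 else 0 := by
  conv_lhs => rw [← Finset.insert_erase hi, Finset.filter_insert]
  have : (S.erase i).filter (fun l => b l = c ∧ z l ≤ z i) = ∅ :=
    Finset.filter_eq_empty_iff.2 fun l hl h => (hmin l hl).not_ge h.2
  rw [this]
  by_cases hc : b i = c <;> simp [hc]

/-- The strict minimum is counted at every later point, so a head adds one unit of advance and a
tail uses one up. A tail with `d = 0` violates the condition at `i` itself. -/
lemma headsLead_iff_of_isMin (hi : i ∈ S) (hmin : ∀ j ∈ S.erase i, z i < z j) (a d : ℕ) :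
    HeadsLead b (a + 1) d S z ↔
      if b i = true then HeadsLead b a (d + 1) (S.erase i) z
      else 1 ≤ d ∧ HeadsLead b (a + 1) (d - 1) (S.erase i) z := by
  have key : HeadsLead b (a + 1) d S z ↔
      (((S.filter fun l => b l = false ∧ z l ≤ z i).card ≤
          (S.filter fun l => b l = true ∧ z l ≤ z i).card + d ∨
        a + 1 ≤ (S.filter fun l => b l = true ∧ z l ≤ z i).card)) ∧
      ∀ j ∈ S.erase i, (S.filter fun l => b l = false ∧ z l ≤ z j).card ≤
          (S.filter fun l => b l = true ∧ z l ≤ z j).card + d ∨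
        a + 1 ≤ (S.filter fun l => b l = true ∧ z l ≤ z j).card := by
    conv_lhs => rw [HeadsLead, ← Finset.insert_erase hi, Finset.forall_mem_insert]
    rw [Finset.insert_erase hi]
  rw [key, card_filter_le_min hi hmin, card_filter_le_min hi hmin]
  by_cases hb : b i = true
  · simp only [hb, if_true, Bool.true_eq_false, if_false]
    rw [and_iff_right (by omega)]
    refine forall₂_congr fun j hj => ?_
    rw [card_filter_le_of_isMin hi hmin _ hj, card_filter_le_of_isMin hi hmin _ hj]
    simp only [hb, if_true, Bool.true_eq_false, if_false]
    omega
  · simp only [Bool.not_eq_true] at hb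
    simp only [hb, if_true, Bool.false_eq_true, if_false]
    rw [show ((1 ≤ 0 + d ∨ a + 1 ≤ 0) ↔ 1 ≤ d) by omega]
    refine and_congr_right fun hd => forall₂_congr fun j hj => ?_
    rw [card_filter_le_of_isMin hi hmin _ hj, card_filter_le_of_isMin hi hmin _ hj]
    simp only [hb, Bool.false_eq_true, if_true, if_false]
    omega

end HeadsLead

/-! ### Competing exponential variables -/

lemma expMeasure_eq_withDensity (r : ℝ) :
    expMeasure r = volume.withDensity (exponentialPDF r) := rfl

instance nullSingletonClass_expMeasure (r : ℝ) : NullSingletonClass (expMeasure r) := by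
  rw [expMeasure_eq_withDensity]; infer_instance

lemma expMeasure_real_Ioi {r : ℝ} (hr : 0 < r) {c : ℝ} (hc : 0 ≤ c) :
    (expMeasure r).real (Set.Ioi c) = Real.exp (-(c * r)) := by
  have := isProbabilityMeasure_expMeasure hr
  rw [← Set.compl_Iic, probReal_compl_eq_one_sub measurableSet_Iic, ← cdf_eq_real,
    cdf_expMeasure_eq hr, if_pos hc, mul_comm c r]
  ring

/-- A variable of rate `r` beats competitors of total rate `s` with probability `r / (r + s)`, and
independently all of them survive time `c`. -/
lemma lintegral_Ioi_exp_expMeasure {r s c : ℝ} (hr : 0 < r) (hs : 0 ≤ s) (hc : 0 ≤ c) :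
    ∫⁻ u in Set.Ioi c, ENNReal.ofReal (Real.exp (-(u * s))) ∂(expMeasure r) =
      ENNReal.ofReal (r / (r + s) * Real.exp (-(c * (r + s)))) := by
  have hrs : -(r + s) < 0 := by linarith
  rw [expMeasure_eq_withDensity, restrict_withDensity measurableSet_Ioi,
    lintegral_withDensity_eq_lintegral_mul _
      (by unfold exponentialPDF; fun_prop) (by fun_prop)]
  have : ∀ u ∈ Set.Ioi c, (exponentialPDF r * fun u => ENNReal.ofReal (Real.exp (-(u * s)))) u =
      ENNReal.ofReal (r * Real.exp (-(r + s) * u)) := by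
    intro u hu
    rw [Pi.mul_apply, exponentialPDF_of_nonneg (hc.trans (le_of_lt hu)),
      ← ENNReal.ofReal_mul (by positivity), mul_assoc, ← Real.exp_add]
    congr 3
    ring
  rw [setLIntegral_congr_fun measurableSet_Ioi this, ← ofReal_integral_eq_lintegral_ofReal]
  · rw [integral_const_mul, integral_exp_mul_Ioi hrs]
    congr 1
    rw [neg_div_neg_eq, show -(r + s) * c = -(c * (r + s)) by ring]
    ring
  · exact (integrableOn_exp_mul_Ioi hrs c).const_mul r
  · exact Eventually.of_forall fun u => by positivity

section Race

variable {Ω ι : Type*} [MeasurableSpace Ω] {P : Measure Ω}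
  {Z : ι → Ω → ℝ} {r : ι → ℝ}

/-- Conditioning on one of several independent variables. -/
lemma ProbabilityTheory.iIndepFun.measure_eq_lintegral [IsProbabilityMeasure P] [DecidableEq ι]
    (hm : ∀ i, AEMeasurable (Z i) P) (hind : iIndepFun Z P) {i : ι} {S : Finset ι} (hi : i ∉ S)
    {D : Set (ℝ × (ι → ℝ))} (hD : MeasurableSet D)
    (hDS : ∀ u z w, (∀ j ∈ S, z j = w j) → ((u, z) ∈ D ↔ (u, w) ∈ D)) :
    P {ω | (Z i ω, fun j => Z j ω) ∈ D} =
      ∫⁻ u, P {ω | (u, fun j => Z j ω) ∈ D} ∂(P.map (Z i)) := by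
  -- Padding by zero makes the `S`-coordinates into a full vector `W` that is independent of `Z i`;
  -- membership in `D` cannot tell it from the original vector.
  let ext : (S → ℝ) → ι → ℝ := fun w j => if h : j ∈ S then w ⟨j, h⟩ else 0
  have hext : Measurable ext := by
    refine measurable_pi_lambda _ fun j => ?_
    by_cases h : j ∈ S
    · simpa [ext, h] using measurable_pi_apply _
    · simp [ext, h]
  let W : Ω → ι → ℝ := fun ω => ext fun j => Z j ω
  have hW : AEMeasurable W P :=
    hext.comp_aemeasurable (aemeasurable_pi_lambda _ fun j => hm j)
  have hproj : Measurable fun f : ({i} : Finset ι) → ℝ => f ⟨i, Finset.mem_singleton_self i⟩ :=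
    measurable_pi_apply _
  have hiW : IndepFun (Z i) W P :=
    (hind.indepFun_finset₀ {i} S (Finset.disjoint_singleton_left.2 hi) hm).comp hproj hext
  have hDW (u : ℝ) (ω : Ω) : (u, fun j => Z j ω) ∈ D ↔ (u, W ω) ∈ D :=
    hDS u _ _ fun j hj => by simp [W, ext, hj]
  simp_rw [hDW]
  calc P {ω | (Z i ω, W ω) ∈ D} = P.map (fun ω => (Z i ω, W ω)) D :=
        (Measure.map_apply_of_aemeasurable ((hm i).prodMk hW) hD).symm
    _ = ∫⁻ u, P.map W (Prod.mk u ⁻¹' D) ∂(P.map (Z i)) := by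
        rw [hiW.map_prod_eq_prod_map_map (hm i) hW, Measure.prod_apply hD]
    _ = _ := lintegral_congr fun u =>
        Measure.map_apply_of_aemeasurable hW (measurable_prodMk_left hD)

lemma ae_ne_of_iIndepFun_exp [IsProbabilityMeasure P] (hZ : ∀ i, HasLaw (Z i) (expMeasure (r i)) P)
    (hind : iIndepFun Z P) {i j : ι} (hij : i ≠ j) : ∀ᵐ ω ∂P, Z i ω ≠ Z j ω := by
  have hm i := (hZ i).aemeasurable
  have hD : MeasurableSet {x : ℝ × ℝ | x.1 = x.2} :=
    measurableSet_eq_fun measurable_fst measurable_snd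
  rw [ae_iff]
  simp only [ne_eq, not_not]
  have : P {ω | Z i ω = Z j ω} = P.map (fun ω => (Z i ω, Z j ω)) {x : ℝ × ℝ | x.1 = x.2} :=
    (Measure.map_apply_of_aemeasurable ((hm i).prodMk (hm j)) hD).symm
  rw [this, (hind.indepFun hij).map_prod_eq_prod_map_map (hm i) (hm j), Measure.prod_apply hD,
    (hZ j).map_eq]
  have h0 (u : ℝ) : expMeasure (r j) (Prod.mk u ⁻¹' {x : ℝ × ℝ | x.1 = x.2}) = 0 := by
    have : Prod.mk u ⁻¹' {x : ℝ × ℝ | x.1 = x.2} = {u} := by ext v; simp [eq_comm]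
    rw [this, measure_singleton]
  simp_rw [h0, lintegral_zero]

lemma measureReal_forall_lt_of_iIndepFun_exp (hr : ∀ i, 0 < r i)
    (hZ : ∀ i, HasLaw (Z i) (expMeasure (r i)) P) (hind : iIndepFun Z P) (S : Finset ι)
    {c : ℝ} (hc : 0 ≤ c) :
    P.real {ω | ∀ i ∈ S, c < Z i ω} = Real.exp (-(c * ∑ i ∈ S, r i)) := by
  have h1 : {ω | ∀ i ∈ S, c < Z i ω} = ⋂ i ∈ S, Z i ⁻¹' Set.Ioi c := by
    ext ω; simp
  rw [h1, measureReal_def,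
    hind.measure_inter_preimage_eq_mul S (sets := fun _ => Set.Ioi c) fun _ _ => measurableSet_Ioi,
    ENNReal.toReal_prod, Finset.mul_sum, ← Finset.sum_neg_distrib, Real.exp_sum]
  refine Finset.prod_congr rfl fun i _ => ?_
  rw [← expMeasure_real_Ioi (hr i) hc, measureReal_def, ← (hZ i).map_eq,
    Measure.map_apply_of_aemeasurable (hZ i).aemeasurable measurableSet_Ioi]

/-- If `Z i` is the first among independent exponential variables after time `c`, the event that
the others satisfy a property of constant conditional probability `v` given the time. -/
lemma measure_first_arrival [IsProbabilityMeasure P] [DecidableEq ι] (hr : ∀ i, 0 < r i)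
    (hZ : ∀ i, HasLaw (Z i) (expMeasure (r i)) P) (hind : iIndepFun Z P)
    {S : Finset ι} {i : ι} (hi : i ∈ S) {c : ℝ} (hc : 0 ≤ c)
    {Q : (ι → ℝ) → Prop} (hQ : MeasurableSet {z | Q z})
    (hQS : ∀ z w, (∀ j ∈ S.erase i, z j = w j) → (Q z ↔ Q w)) {v : ℝ}
    (hv : ∀ u, 0 ≤ u → P.real {ω | (∀ j ∈ S.erase i, u < Z j ω) ∧ Q fun j => Z j ω} =
      Real.exp (-(u * ∑ j ∈ S.erase i, r j)) * v) :
    P.real {ω | c < Z i ω ∧ (∀ j ∈ S.erase i, Z i ω < Z j ω) ∧ Q fun j => Z j ω} =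
      Real.exp (-(c * ∑ j ∈ S, r j)) * (r i / (∑ j ∈ S, r j) * v) := by
  set D : Set (ℝ × (ι → ℝ)) := {x | c < x.1 ∧ (∀ j ∈ S.erase i, x.1 < x.2 j) ∧ Q x.2} with hDdef
  have hD : MeasurableSet D := by
    refine (measurableSet_lt measurable_const measurable_fst).inter (MeasurableSet.inter ?_ ?_)
    · have : {x : ℝ × (ι → ℝ) | ∀ j ∈ S.erase i, x.1 < x.2 j} =
          ⋂ j ∈ S.erase i, {x | x.1 < x.2 j} := by ext x; simp
      change MeasurableSet {x : ℝ × (ι → ℝ) | ∀ j ∈ S.erase i, x.1 < x.2 j}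
      rw [this]
      exact Finset.measurableSet_biInter _ fun j _ =>
        measurableSet_lt measurable_fst (by fun_prop)
    · exact measurable_snd hQ
  have hDS : ∀ u z w, (∀ j ∈ S.erase i, z j = w j) → ((u, z) ∈ D ↔ (u, w) ∈ D) := by
    intro u z w h
    simp only [hDdef, Set.mem_ofPred_eq]
    rw [hQS z w h]
    refine and_congr_right fun _ => and_congr_left fun _ => forall₂_congr fun j hj => ?_
    rw [h j hj]
  have hv0 : 0 ≤ v := by
    have := hv 0 le_rfl
    simp only [zero_mul, neg_zero, Real.exp_zero, one_mul] at this
    rw [← this]; exact measureReal_nonneg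
  have hs : 0 ≤ ∑ j ∈ S.erase i, r j := Finset.sum_nonneg fun j _ => (hr j).le
  have key : P {ω | (Z i ω, fun j => Z j ω) ∈ D} = ENNReal.ofReal
      (Real.exp (-(c * ∑ j ∈ S, r j)) * (r i / (∑ j ∈ S, r j) * v)) := by
    rw [hind.measure_eq_lintegral (fun i => (hZ i).aemeasurable) (Finset.notMem_erase i S) hD hDS,
      (hZ i).map_eq]
    have h1 (u : ℝ) : P {ω | (u, fun j => Z j ω) ∈ D} = (Set.Ioi c).indicator
        (fun u => ENNReal.ofReal (Real.exp (-(u * ∑ j ∈ S.erase i, r j))) * ENNReal.ofReal v) u := by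
      by_cases hu : c < u
      · rw [Set.indicator_of_mem (Set.mem_Ioi.2 hu), ← ENNReal.ofReal_mul (Real.exp_pos _).le,
          ← hv u (hc.trans hu.le), ofReal_measureReal]
        simp [hDdef, hu]
      · rw [Set.indicator_of_notMem (by simpa using hu)]
        simp [hDdef, hu]
    simp_rw [h1]
    rw [lintegral_indicator measurableSet_Ioi, lintegral_mul_const _ (by fun_prop),
      lintegral_Ioi_exp_expMeasure (hr i) hs hc, ← ENNReal.ofReal_mul (by have := hr i; positivity),
      Finset.add_sum_erase S r hi]
    congr 1
    ring
  rw [measureReal_def]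
  change (P {ω | (Z i ω, fun j => Z j ω) ∈ D}).toReal = _
  rw [key, ENNReal.toReal_ofReal]
  have := Finset.sum_nonneg fun j (_ : j ∈ S) => (hr j).le
  have := hr i
  positivity

/-- The probability that heads lead in the pooled sample of independent exponential variables. -/
theorem measureReal_headsLead [IsProbabilityMeasure P] [Countable ι] [DecidableEq ι]
    {b : ι → Bool} {κ : ℝ} (hκ : 0 < κ)
    (hZ : ∀ i, HasLaw (Z i) (expMeasure (if b i = true then 1 else κ)) P) (hind : iIndepFun Z P)
    (S : Finset ι) (a d : ℕ) (ha : a ≤ (S.filter fun i => b i = true).card) {c : ℝ} (hc : 0 ≤ c) :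
    P.real {ω | (∀ i ∈ S, c < Z i ω) ∧ HeadsLead b a d S fun i => Z i ω} =
      Real.exp (-(c * ∑ i ∈ S, if b i = true then 1 else κ)) *
        urnRace κ a d (S.filter fun i => b i = true).card (S.filter fun i => ¬ b i = true).card := by
  have hr (i : ι) : 0 < if b i = true then 1 else κ := by split_ifs <;> positivity
  -- The time `c` varies in the induction: once the first point falls at `u`, the others are
  -- required to exceed `u`.
  induction S using Finset.strongInduction generalizing a d c with
  | H S ih =>
  match a with
  | 0 =>
    simp only [headsLead_zero, and_true, urnRace, mul_one]
    exact measureReal_forall_lt_of_iIndepFun_exp hr hZ hind S hc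
  | a + 1 =>
    set n := (S.filter fun i => b i = true).card with hn
    set m := (S.filter fun i => ¬ b i = true).card with hm
    -- `Q i` is what remains to be satisfied once `i` comes first, and `v i` is its conditional
    -- probability.
    let Q : ι → (ι → ℝ) → Prop := fun i z =>
      if b i = true then HeadsLead b a (d + 1) (S.erase i) z
      else 1 ≤ d ∧ HeadsLead b (a + 1) (d - 1) (S.erase i) z
    let v : ι → ℝ := fun i => if b i = true then urnRace κ a (d + 1) (n - 1) m
      else if 1 ≤ d then urnRace κ (a + 1) (d - 1) n (m - 1) else 0
    let A : ι → Set Ω := fun i =>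
      {ω | c < Z i ω ∧ (∀ j ∈ S.erase i, Z i ω < Z j ω) ∧ Q i fun j => Z j ω}
    have hQ (i : ι) : MeasurableSet {z | Q i z} := by
      by_cases hb : b i = true
      · simpa [Q, hb] using measurableSet_headsLead a (d + 1) (S.erase i)
      · simp only [Q, if_neg hb]
        exact (MeasurableSet.const (1 ≤ d)).inter
          (measurableSet_headsLead (a + 1) (d - 1) (S.erase i))
    have hQS (i : ι) (z w : ι → ℝ) (h : ∀ j ∈ S.erase i, z j = w j) : Q i z ↔ Q i w := by
      simp only [Q, headsLead_congr h]
    have hA (i : ι) (hi : i ∈ S) : P.real (A i) =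
        Real.exp (-(c * ∑ i ∈ S, if b i = true then 1 else κ)) *
          ((if b i = true then 1 else κ) / (∑ i ∈ S, if b i = true then 1 else κ) * v i) := by
      refine measure_first_arrival hr hZ hind hi hc (hQ i) (hQS i) fun u hu => ?_
      by_cases hb : b i = true
      · have h1 : ((S.erase i).filter fun i => b i = true).card = n - 1 := by
          rw [Finset.filter_erase, Finset.card_erase_of_mem (by simp [hi, hb])]
        have h2 : ((S.erase i).filter fun i => ¬ b i = true).card = m := by
          rw [Finset.filter_erase, Finset.erase_eq_of_notMem (by simp [hb])]
        simp only [Q, v, hb, if_true]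
        rw [ih _ (Finset.erase_ssubset hi) a (d + 1) (by omega) hu, h1, h2]
      · have h1 : ((S.erase i).filter fun i => b i = true).card = n := by
          rw [Finset.filter_erase, Finset.erase_eq_of_notMem (by simp [hb])]
        have h2 : ((S.erase i).filter fun i => ¬ b i = true).card = m - 1 := by
          rw [Finset.filter_erase, Finset.card_erase_of_mem (by simp [hi, hb])]
        simp only [Q, v, if_neg hb]
        by_cases hd : 1 ≤ d
        · simp only [hd, true_and, if_true]
          rw [ih _ (Finset.erase_ssubset hi) (a + 1) (d - 1) (by omega) hu, h1, h2]
        · simp [hd]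
    have hAm (i : ι) : NullMeasurableSet (A i) P := by
      have hmeas : MeasurableSet {z : ι → ℝ | c < z i ∧ (∀ j ∈ S.erase i, z i < z j) ∧ Q i z} := by
        refine (measurableSet_lt measurable_const (measurable_pi_apply i)).inter
          (MeasurableSet.inter ?_ (hQ i))
        have : {z : ι → ℝ | ∀ j ∈ S.erase i, z i < z j} =
            ⋂ j ∈ S.erase i, {z | z i < z j} := by ext x; simp
        change MeasurableSet {z : ι → ℝ | ∀ j ∈ S.erase i, z i < z j}
        rw [this]
        exact Finset.measurableSet_biInter _ fun j _ =>
          measurableSet_lt (measurable_pi_apply i) (measurable_pi_apply j)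
      exact (aemeasurable_pi_lambda (fun ω i => Z i ω) fun i =>
        (hZ i).aemeasurable).nullMeasurable hmeas
    have hdisj : Set.PairwiseDisjoint (S : Set ι) A := by
      intro i hi j hj hij
      refine Set.disjoint_left.2 fun ω h1 h2 => ?_
      exact lt_asymm (h1.2.1 j (Finset.mem_erase.2 ⟨hij.symm, hj⟩))
        (h2.2.1 i (Finset.mem_erase.2 ⟨hij, hi⟩))
    -- Here enough heads must remain: on an empty `S` the event holds vacuously, while the recursion
    -- gives `0`.
    have hne : S.Nonempty :=
      (Finset.card_pos.1 (by omega : 0 < n)).mono (Finset.filter_subset _ _)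
    -- Ties have probability zero, so the event splits according to which point is first.
    have hEA : {ω | (∀ i ∈ S, c < Z i ω) ∧ HeadsLead b (a + 1) d S fun i => Z i ω} =ᵐ[P]
        ⋃ i ∈ S, A i := by
      have hties : ∀ᵐ ω ∂P, ∀ i ∈ S, ∀ j ∈ S, i ≠ j → Z i ω ≠ Z j ω := by
        refine (ae_ball_iff S.countable_toSet).2 fun i _ =>
          (ae_ball_iff S.countable_toSet).2 fun j _ => ?_
        by_cases hij : i = j
        · simp [hij]
        · simpa [hij] using ae_ne_of_iIndepFun_exp hZ hind hij
      filter_upwards [hties] with ω hω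
      refine propext ?_
      change ((∀ i ∈ S, c < Z i ω) ∧ HeadsLead b (a + 1) d S fun i => Z i ω) ↔ ω ∈ ⋃ i ∈ S, A i
      simp only [Set.mem_iUnion, exists_prop]
      constructor
      · rintro ⟨h1, h2⟩
        obtain ⟨i, hi, hmin⟩ := Finset.exists_min_image S (fun i => Z i ω) hne
        have hlt : ∀ j ∈ S.erase i, Z i ω < Z j ω := fun j hj =>
          lt_of_le_of_ne (hmin j (Finset.mem_of_mem_erase hj))
            (hω i hi j (Finset.mem_of_mem_erase hj) (Finset.ne_of_mem_erase hj).symm)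
        exact ⟨i, hi, h1 i hi, hlt, (headsLead_iff_of_isMin hi hlt a d).1 h2⟩
      · rintro ⟨i, hi, h1, hlt, h2⟩
        refine ⟨fun j hj => ?_, (headsLead_iff_of_isMin hi hlt a d).2 h2⟩
        by_cases hij : j = i
        · rwa [hij]
        · exact h1.trans (hlt j (Finset.mem_erase.2 ⟨hij, hj⟩))
    have hR : (∑ i ∈ S, if b i = true then 1 else κ) = n + κ * m := by
      rw [Finset.sum_ite, Finset.sum_const, Finset.sum_const, nsmul_eq_mul, nsmul_eq_mul]
      ring
    have hterm (i : ι) : (if b i = true then 1 else κ) / (n + κ * m) * v i =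
        if b i = true then 1 / (n + κ * m) * urnRace κ a (d + 1) (n - 1) m
        else κ / (n + κ * m) * if 1 ≤ d then urnRace κ (a + 1) (d - 1) n (m - 1) else 0 := by
      by_cases hb : b i = true <;> simp [v, hb]
    have hPU : P.real (⋃ i ∈ S, A i) = ∑ i ∈ S, P.real (A i) := by
      simp only [measureReal_def]
      rw [measure_biUnion_finset₀ (hdisj.aedisjoint) fun i _ => hAm i,
        ENNReal.toReal_sum fun i _ => measure_ne_top P _]
    rw [measureReal_congr hEA, hPU, Finset.sum_congr rfl hA, ← Finset.mul_sum, hR]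
    simp_rw [hterm]
    rw [Finset.sum_ite, Finset.sum_const, Finset.sum_const, nsmul_eq_mul, nsmul_eq_mul, ← hn, ← hm]
    cases d with
    | zero =>
      simp only [urnRace]
      norm_num
      ring
    | succ d =>
      simp only [urnRace]
      norm_num
      ring

end Race

/-! ### Order statistics as counts -/

section OrderStatistics

variable {n : ℕ}

/-- Sorting preserves the number of entries below `s`. Indices start at `0`, hence the strict
inequality. -/
lemma orderStat_le_iff (x : Fin n → ℝ) (i : Fin n) (s : ℝ) :
    orderStat x i ≤ s ↔ (i : ℕ) < (Finset.univ.filter fun j => x j ≤ s).card := by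
  have hcard : (Finset.univ.filter fun j => orderStat x j ≤ s).card =
      (Finset.univ.filter fun j => x j ≤ s).card := by
    rw [Finset.card_filter, Finset.card_filter]
    exact Equiv.sum_comp (Tuple.sort x) fun j => if x j ≤ s then 1 else 0
  rw [← hcard]
  exact (Tuple.lt_card_le_iff_apply_le_of_monotone (Tuple.monotone_sort x)).symm

lemma orderStat_const_mul {t : ℝ} (ht : 0 < t) (x : Fin n → ℝ) (i : Fin n) :
    orderStat (fun j => t * x j) i = t * orderStat x i := by
  refine eq_of_forall_ge_iff fun s => ?_
  rw [← le_div_iff₀' ht, orderStat_le_iff, orderStat_le_iff]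
  simp only [le_div_iff₀' ht]

lemma measurable_orderStat (i : Fin n) : Measurable fun x : Fin n → ℝ => orderStat x i := by
  refine measurable_of_Iic fun s => ?_
  have hpre : (fun x : Fin n → ℝ => orderStat x i) ⁻¹' Set.Iic s =
      {x | (i : ℕ) < (Finset.univ.filter fun j => x j ≤ s).card} := by
    ext x; exact orderStat_le_iff x i s
  rw [hpre]
  simp only [Finset.card_filter]
  refine measurableSet_lt measurable_const (Finset.measurable_sum _ fun j _ =>
    Measurable.ite ?_ measurable_const measurable_const)
  exact measurableSet_le (measurable_pi_apply j) measurable_const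

lemma measurable_maxRankedQuotient (Λ : Finset (Fin n)) :
    Measurable fun x : (Fin n → ℝ) × (Fin n → ℝ) => maxRankedQuotient Λ x.1 x.2 := by
  by_cases h : Λ.Nonempty
  · have hfun : (fun x : (Fin n → ℝ) × (Fin n → ℝ) => maxRankedQuotient Λ x.1 x.2) =
        Λ.sup' h fun i x => orderStat x.1 i / orderStat x.2 i := by
      ext x
      simp [maxRankedQuotient, h, Finset.sup'_apply]
    rw [hfun]
    exact Finset.measurable_sup' h fun i _ =>
      ((measurable_orderStat i).comp measurable_fst).div
        ((measurable_orderStat i).comp measurable_snd)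
  · simp [maxRankedQuotient, h]

lemma forall_orderStat_le_iff_headsLead (x y : Fin n → ℝ) (ℓ : ℕ) :
    (∀ i : Fin n, (i : ℕ) < ℓ → orderStat x i ≤ orderStat y i) ↔
      HeadsLead Sum.isLeft ℓ 0 Finset.univ (Sum.elim x y) := by
  have hleft (s : ℝ) : (Finset.univ.filter fun i : Fin n ⊕ Fin n =>
      i.isLeft = true ∧ Sum.elim x y i ≤ s).card = (Finset.univ.filter fun j => x j ≤ s).card := by
    rw [Finset.card_filter, Fintype.sum_sum_type]
    simp
  have hright (s : ℝ) : (Finset.univ.filter fun i : Fin n ⊕ Fin n =>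
      i.isLeft = false ∧ Sum.elim x y i ≤ s).card =
        (Finset.univ.filter fun j => y j ≤ s).card := by
    rw [Finset.card_filter, Fintype.sum_sum_type]
    simp
  simp only [HeadsLead, hleft, hright]
  constructor
  · intro h k _
    set s := Sum.elim x y k
    by_contra! hcon
    have hn : (Finset.univ.filter fun j => y j ≤ s).card ≤ n := by
      simpa using Finset.card_le_univ (Finset.univ.filter fun j => y j ≤ s)
    -- If tails lead at `s`, take as rank index the number of heads up to `s`: that `y`-order
    -- statistic is at most `s`, but the `x`-one is not.
    let i : Fin n := ⟨(Finset.univ.filter fun j => x j ≤ s).card, by omega⟩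
    have hy : orderStat y i ≤ s := (orderStat_le_iff y i s).2 (by simp only [i]; omega)
    exact lt_irrefl _ ((orderStat_le_iff x i s).1 ((h i hcon.2).trans hy))
  · intro h i hi
    rw [orderStat_le_iff]
    have hy := (orderStat_le_iff y i _).1 le_rfl
    -- The condition is tested at the sample point with value `orderStat y i`.
    rcases h (Sum.inr (Tuple.sort y i)) (Finset.mem_univ _) with h1 | h1
    · exact hy.trans_le h1
    · exact hi.trans_le h1

lemma leftIndices_nonempty {ℓ : ℕ} (hn : 1 ≤ n) (hℓ : 1 ≤ ℓ) : (leftIndices n ℓ).Nonempty :=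
  ⟨⟨0, hn⟩, by simp only [leftIndices, Finset.mem_filter, Finset.mem_univ, true_and]; omega⟩

lemma maxRankedQuotient_le_iff {ℓ : ℕ} (hn : 1 ≤ n) (hℓ : 1 ≤ ℓ) {x y : Fin n → ℝ}
    (hy : ∀ j, 0 < y j) (t : ℝ) :
    maxRankedQuotient (leftIndices n ℓ) x y ≤ t ↔
      ∀ i : Fin n, (i : ℕ) < ℓ → orderStat x i ≤ t * orderStat y i := by
  rw [maxRankedQuotient, dif_pos (leftIndices_nonempty hn hℓ), Finset.sup'_le_iff]
  simp only [leftIndices, Finset.mem_filter, Finset.mem_univ, true_and]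
  refine forall₂_congr fun i _ => div_le_iff₀ (hy _)

end OrderStatistics

/-! ### Exact law of the maximum ranked quotient for finite samples -/

lemma ae_pos_expMeasure {r : ℝ} (hr : 0 < r) : ∀ᵐ x ∂(expMeasure r), 0 < x := by
  have := isProbabilityMeasure_expMeasure hr
  rw [ae_iff]
  simp only [not_lt]
  change expMeasure r (Set.Iic 0) = 0
  rw [← ofReal_cdf, cdf_expMeasure_eq hr]
  simp

lemma hasLaw_const_mul_exp {Ω : Type*} [MeasurableSpace Ω] {P : Measure Ω}
    [IsProbabilityMeasure P] {Y : Ω → ℝ} (hY : HasLaw Y (expMeasure 1) P) {t : ℝ} (ht : 0 < t) :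
    HasLaw (fun ω => t * Y ω) (expMeasure (1 / t)) P where
  aemeasurable := hY.aemeasurable.const_mul t
  map_eq := by
    have hm := hY.aemeasurable.const_mul t
    have := isProbabilityMeasure_expMeasure (one_div_pos.2 ht)
    have := isProbabilityMeasure_expMeasure one_pos
    have := Measure.isProbabilityMeasure_map hm
    refine Measure.eq_of_cdf _ _ (StieltjesFunction.ext fun s => ?_)
    have hpre : (P.map fun ω => t * Y ω).real (Set.Iic s) = cdf (expMeasure 1) (s / t) := by
      rw [cdf_eq_real, ← hY.map_eq, map_measureReal_apply_of_aemeasurable hm measurableSet_Iic,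
        map_measureReal_apply_of_aemeasurable hY.aemeasurable measurableSet_Iic]
      congr 1
      ext ω
      simp [le_div_iff₀' ht]
    rw [cdf_eq_real, hpre, cdf_expMeasure_eq one_pos, cdf_expMeasure_eq (one_div_pos.2 ht)]
    have h0 : 0 ≤ s / t ↔ 0 ≤ s := by rw [le_div_iff₀ ht, zero_mul]
    simp only [h0, one_mul]
    rw [one_div_mul_eq_div]

section MaxRankedQuotient

variable {Ω : Type*} [MeasurableSpace Ω] {P : Measure Ω} {n : ℕ}
  {X Y : Fin n → Ω → ℝ}

lemma ae_forall_pos_of_hasLaw_exp (hX : ∀ i, HasLaw (X i) (expMeasure 1) P) :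
    ∀ᵐ ω ∂P, ∀ i, 0 < X i ω :=
  ae_all_iff.2 fun i =>
    ((hX i).ae_iff (measurableSet_setOfPred.1 measurableSet_Ioi)).2 (ae_pos_expMeasure one_pos)

theorem measureReal_maxRankedQuotient_le [IsProbabilityMeasure P]
    (hX : ∀ i, HasLaw (X i) (expMeasure 1) P)
    (hY : ∀ i, HasLaw (Y i) (expMeasure 1) P) (hXY : iIndepFun (Sum.elim X Y) P)
    {ℓ : ℕ} (hℓ : 1 ≤ ℓ) (hn : ℓ ≤ n) {t : ℝ} (ht : 0 < t) :
    P.real {ω | maxRankedQuotient (leftIndices n ℓ) (fun i => X i ω) (fun i => Y i ω) ≤ t} =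
      urnRace (1 / t) ℓ 0 n n := by
  let Z : Fin n ⊕ Fin n → Ω → ℝ := Sum.elim X fun j ω => t * Y j ω
  have hZ : ∀ i, HasLaw (Z i) (expMeasure (if i.isLeft = true then 1 else 1 / t)) P := by
    rintro (i | i)
    · simpa [Z] using hX i
    · simpa [Z] using hasLaw_const_mul_exp (hY i) ht
  have hind : iIndepFun Z P := by
    have h := hXY.comp (γ := fun _ => ℝ) (Sum.elim (fun _ x => x) fun _ x => t * x)
      (by rintro (i | i) <;> simp only [Sum.elim_inl, Sum.elim_inr] <;> fun_prop)
    refine h.congr fun i => ?_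
    rcases i with i | i <;> exact EventuallyEq.rfl
  have hcl : (Finset.univ.filter fun i : Fin n ⊕ Fin n => i.isLeft = true).card = n := by
    rw [Finset.card_filter, Fintype.sum_sum_type]
    simp
  have hcr : (Finset.univ.filter fun i : Fin n ⊕ Fin n => ¬ i.isLeft = true).card = n := by
    rw [Finset.card_filter, Fintype.sum_sum_type]
    simp
  -- At `c = 0` the survival factor is `1`, and the constraint `0 < Z i` holds almost surely.
  have key := measureReal_headsLead (one_div_pos.2 ht) hZ hind Finset.univ ℓ 0
    (by rw [hcl]; exact hn) le_rfl
  rw [hcl, hcr, zero_mul, neg_zero, Real.exp_zero, one_mul] at key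
  rw [← key]
  refine measureReal_congr ?_
  filter_upwards [ae_forall_pos_of_hasLaw_exp hX, ae_forall_pos_of_hasLaw_exp hY] with ω h1 h2
  refine propext ?_
  change maxRankedQuotient (leftIndices n ℓ) (fun i => X i ω) (fun i => Y i ω) ≤ t ↔
    (∀ i ∈ Finset.univ, 0 < Z i ω) ∧ HeadsLead Sum.isLeft ℓ 0 Finset.univ fun i => Z i ω
  have hZω : (fun i => Z i ω) = Sum.elim (fun i => X i ω) fun j => t * Y j ω := by
    ext i; rcases i with i | i <;> rfl
  rw [maxRankedQuotient_le_iff (hℓ.trans hn) hℓ h2, hZω, ← forall_orderStat_le_iff_headsLead]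
  simp only [orderStat_const_mul ht]
  refine (and_iff_right ?_).symm
  rintro (i | i) _
  · exact h1 i
  · exact mul_pos ht (h2 i)

lemma measureReal_maxRankedQuotient_le_of_nonpos (hX : ∀ i, HasLaw (X i) (expMeasure 1) P)
    (hY : ∀ i, HasLaw (Y i) (expMeasure 1) P) {ℓ : ℕ} (hℓ : 1 ≤ ℓ) (hn : 1 ≤ n)
    {t : ℝ} (ht : t ≤ 0) :
    P.real {ω | maxRankedQuotient (leftIndices n ℓ) (fun i => X i ω) (fun i => Y i ω) ≤ t} = 0 := by
  have h0 : ∀ᵐ ω ∂P,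
      ¬ maxRankedQuotient (leftIndices n ℓ) (fun i => X i ω) (fun i => Y i ω) ≤ t := by
    filter_upwards [ae_forall_pos_of_hasLaw_exp hX, ae_forall_pos_of_hasLaw_exp hY] with ω h1 h2 h
    rw [maxRankedQuotient_le_iff hn hℓ h2] at h
    have h3 : orderStat (fun i => X i ω) ⟨0, hn⟩ ≤ 0 :=
      (h ⟨0, hn⟩ hℓ).trans (mul_nonpos_of_nonpos_of_nonneg ht (h2 _).le)
    exact (h1 _).not_ge h3
  rw [ae_iff] at h0
  simp only [not_not] at h0
  rw [measureReal_def, h0, ENNReal.toReal_zero]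

end MaxRankedQuotient

/-! ### The limiting distribution function and weak convergence -/

/-- Writing `1 / k` as `t / (1 + t)` removes the singularity at `t = 0`, and the truncation `max t
0` covers `t ≤ 0`, where heads have weight `0`. Continuity on the whole line follows. -/
lemma leftLimitCDF_eq_coinRace {ℓ : ℕ} (hℓ : 1 ≤ ℓ) (t : ℝ) :
    leftLimitCDF ℓ t =
      coinRace (max t 0 / (1 + max t 0)) (1 - max t 0 / (1 + max t 0)) ℓ 0 := by
  rcases lt_or_ge 0 t with ht | ht
  · have hp : t / (1 + t) = 1 / (1 + 1 / t) := by field_simp; ring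
    rw [leftLimitCDF, if_pos ht, leftLimitExpr_eq_coinRace hℓ (by positivity), max_eq_left ht.le,
      hp]
  · obtain ⟨m, rfl⟩ := Nat.exists_eq_add_of_le' hℓ
    rw [leftLimitCDF, if_neg ht.not_gt, max_eq_right ht, zero_div, sub_zero, coinRace_zero_one]

lemma continuous_leftLimitCDF {ℓ : ℕ} (hℓ : 1 ≤ ℓ) : Continuous (leftLimitCDF ℓ) := by
  rw [funext (leftLimitCDF_eq_coinRace hℓ)]
  refine (continuous_coinRace ℓ 0).comp (Continuous.div (by fun_prop) (by fun_prop) fun t => ?_)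
  positivity

lemma tendsto_leftLimitCDF_atBot (ℓ : ℕ) : Tendsto (leftLimitCDF ℓ) atBot (𝓝 0) := by
  refine tendsto_const_nhds.congr' ?_
  filter_upwards [eventually_le_atBot 0] with t ht
  rw [leftLimitCDF, if_neg ht.not_gt]

lemma tendsto_leftLimitCDF_atTop {ℓ : ℕ} (hℓ : 1 ≤ ℓ) :
    Tendsto (leftLimitCDF ℓ) atTop (𝓝 1) := by
  have hp : Tendsto (fun t : ℝ => 1 / (1 + 1 / t)) atTop (𝓝 (1 / (1 + 0))) := by
    simp only [one_div]
    exact (tendsto_const_nhds.add tendsto_inv_atTop_zero).inv₀ (by norm_num)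
  have h := ((continuous_coinRace ℓ 0).tendsto _).comp hp
  rw [add_zero, div_one, sub_self, coinRace_one_zero] at h
  refine h.congr' ?_
  filter_upwards [eventually_gt_atTop 0] with t ht
  rw [leftLimitCDF, if_pos ht, leftLimitExpr_eq_coinRace hℓ (by positivity)]
  rfl

/-- Pointwise convergence of distribution functions implies weak convergence. -/
lemma tendsto_probabilityMeasure_of_tendsto_cdf {ι : Type*} {l : Filter ι}
    [l.IsCountablyGenerated] {μ : ι → ProbabilityMeasure ℝ} {ν : ProbabilityMeasure ℝ}
    (h : ∀ t, Tendsto (fun i => cdf (μ i : Measure ℝ) t) l (𝓝 (cdf (ν : Measure ℝ) t))) :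
    Tendsto μ l (𝓝 ν) := by
  have hIoc (ρ : ProbabilityMeasure ℝ) {a b : ℝ} (hab : a < b) :
      (ρ : Measure ℝ).real (Set.Ioc a b) =
        cdf (ρ : Measure ℝ) b - cdf (ρ : Measure ℝ) a := by
    rw [← Set.Iic_sdiff_Iic, measureReal_sdiff (Set.Iic_subset_Iic.2 hab.le) measurableSet_Iic,
      cdf_eq_real, cdf_eq_real]
  -- Half-open intervals form a π-system containing small neighbourhoods of each point, and their
  -- masses are differences of distribution functions.
  refine (isPiSystem_Ioc (id : ℝ → ℝ) id).tendsto_probabilityMeasure_of_tendsto_of_mem ?_ ?_ ?_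
  · rintro _ ⟨a, b, _, rfl⟩
    exact measurableSet_Ioc
  · intro u hu x hx
    obtain ⟨ε, hε, hsub⟩ := Metric.isOpen_iff.1 hu x hx
    refine ⟨Set.Ioc (x - ε / 2) (x + ε / 2), ⟨x - ε / 2, x + ε / 2, by simp; linarith, rfl⟩,
      Ioc_mem_nhds (by linarith) (by linarith), fun y hy => hsub ?_⟩
    rw [Metric.mem_ball, Real.dist_eq, abs_lt]
    constructor <;> linarith [hy.1, hy.2]
  · rintro _ ⟨a, b, hab, rfl⟩
    rw [← NNReal.tendsto_coe]
    change Tendsto (fun i => (μ i : Measure ℝ).real (Set.Ioc a b)) l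
      (𝓝 ((ν : Measure ℝ).real (Set.Ioc a b)))
    have hab : a < b := hab
    simp only [hIoc _ hab]
    exact (h b).sub (h a)

/-- A continuous distribution function is that of a probability measure without point masses. -/
lemma exists_probabilityMeasure_cdf_eq {f : ℝ → ℝ} (hmono : Monotone f) (hcont : Continuous f)
    (h0 : Tendsto f atBot (𝓝 0)) (h1 : Tendsto f atTop (𝓝 1)) :
    ∃ ν : ProbabilityMeasure ℝ, (∀ a : ℝ, (ν : Measure ℝ) ≠ Measure.dirac a) ∧
      ∀ t, cdf (ν : Measure ℝ) t = f t := by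
  let F : StieltjesFunction ℝ := ⟨f, hmono, fun x => hcont.continuousWithinAt⟩
  have hprob : IsProbabilityMeasure F.measure :=
    ⟨by rw [F.measure_univ h0 h1, sub_zero, ENNReal.ofReal_one]⟩
  refine ⟨⟨F.measure, hprob⟩, fun a (h : F.measure = Measure.dirac a) => ?_, fun t => ?_⟩
  · have hzero : F.measure {a} = 0 := by
      have hl : Function.leftLim F a = f a :=
        hcont.continuousAt.continuousWithinAt.leftLim_eq
      rw [F.measure_singleton, hl]
      exact ENNReal.ofReal_eq_zero.2 (sub_self (f a)).le
    rw [h] at hzero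
    simp at hzero
  · rw [ProbabilityMeasure.coe_mk, cdf_measure_stieltjesFunction F h0 h1]

lemma aemeasurable_maxRankedQuotient {Ω : Type*} [MeasurableSpace Ω] {P : Measure Ω} {n : ℕ}
    {X Y : Fin n → Ω → ℝ} (hX : ∀ i, AEMeasurable (X i) P) (hY : ∀ i, AEMeasurable (Y i) P)
    (Λ : Finset (Fin n)) :
    AEMeasurable (fun ω => maxRankedQuotient Λ (fun i => X i ω) fun i => Y i ω) P := by
  have hX' : AEMeasurable (fun ω i => X i ω) P := aemeasurable_pi_lambda _ hX
  have hY' : AEMeasurable (fun ω i => Y i ω) P := aemeasurable_pi_lambda _ hY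
  have hXY : AEMeasurable (fun ω => ((fun i => X i ω), fun i => Y i ω)) P := hX'.prodMk hY'
  simpa only [Function.comp_def] using (measurable_maxRankedQuotient Λ).comp_aemeasurable hXY

lemma tendstoInDistribution_of_tendsto_measureReal_le {Ω : ℕ → Type*}
    [∀ n, MeasurableSpace (Ω n)] {P : (n : ℕ) → Measure (Ω n)} [∀ n, IsProbabilityMeasure (P n)]
    {M : (n : ℕ) → Ω n → ℝ} (hM : ∀ n, AEMeasurable (M n) (P n)) {ν : ProbabilityMeasure ℝ}
    (h : ∀ t, Tendsto (fun n => (P n).real {ω | M n ω ≤ t}) atTop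
      (𝓝 (cdf (ν : Measure ℝ) t))) :
    TendstoInDistribution M atTop (id : ℝ → ℝ) P (ν : Measure ℝ) := by
  refine ⟨hM, aemeasurable_id, tendsto_probabilityMeasure_of_tendsto_cdf fun t => ?_⟩
  simp only [ProbabilityMeasure.coe_mk, Measure.map_id]
  refine (h t).congr fun n => ?_
  have := Measure.isProbabilityMeasure_map (hM n)
  rw [cdf_eq_real, map_measureReal_apply_of_aemeasurable (hM n) measurableSet_Iic]
  rfl

/-- The distribution functions of the maximum ranked quotients converge pointwise. -/
theorem tendsto_measureReal_maxRankedQuotient_le {Ω : ℕ → Type*} [∀ n, MeasurableSpace (Ω n)]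
    {P : (n : ℕ) → Measure (Ω n)} [∀ n, IsProbabilityMeasure (P n)]
    {X Y : (n : ℕ) → Fin n → Ω n → ℝ}
    (hX : ∀ n i, HasLaw (X n i) (expMeasure 1) (P n))
    (hY : ∀ n i, HasLaw (Y n i) (expMeasure 1) (P n))
    (hXY : ∀ n, iIndepFun (Sum.elim (X n) (Y n)) (P n))
    {ℓ : ℕ} (hℓ : 1 ≤ ℓ) (t : ℝ) :
    Tendsto
      (fun n => (P n).real {ω |
        maxRankedQuotient (leftIndices n ℓ) (fun i => X n i ω) (fun i => Y n i ω) ≤ t})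
      atTop (𝓝 (leftLimitCDF ℓ t)) := by
  rcases lt_or_ge 0 t with ht | ht
  · have hk : (1 : ℝ) + 1 / t ≠ 0 := by positivity
    have h := tendsto_urnRace (one_div_pos.2 ht) ℓ 0 0 0
    rw [show 1 / t / (1 + 1 / t) = 1 - 1 / (1 + 1 / t) by
        rw [eq_sub_iff_add_eq, ← add_div, add_comm, div_self hk],
      ← leftLimitExpr_eq_coinRace hℓ hk] at h
    rw [leftLimitCDF, if_pos ht]
    refine h.congr' ?_
    filter_upwards [eventually_ge_atTop ℓ] with n hn
    exact (measureReal_maxRankedQuotient_le (hX n) (hY n) (hXY n) hℓ hn ht).symm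
  · rw [leftLimitCDF, if_neg ht.not_gt]
    refine tendsto_const_nhds.congr' ?_
    filter_upwards [eventually_ge_atTop 1] with n hn
    exact (measureReal_maxRankedQuotient_le_of_nonpos (hX n) (hY n) hℓ hn ht).symm

theorem theorem3 {Ω : ℕ → Type*} [∀ n, MeasurableSpace (Ω n)]
    (P : (n : ℕ) → Measure (Ω n)) [∀ n, IsProbabilityMeasure (P n)]
    (X Y : (n : ℕ) → Fin n → Ω n → ℝ)
    (hX : ∀ n i, HasLaw (X n i) (expMeasure 1) (P n))
    (hY : ∀ n i, HasLaw (Y n i) (expMeasure 1) (P n))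
    (hXY : ∀ n, iIndepFun (Sum.elim (X n) (Y n)) (P n))
    (ℓ : ℕ) (hℓ : 1 ≤ ℓ) :
    ∃ ν : ProbabilityMeasure ℝ,
      (∀ a : ℝ, (ν : Measure ℝ) ≠ Measure.dirac a) ∧
      TendstoInDistribution
        (fun n ω => maxRankedQuotient (leftIndices n ℓ) (fun i => X n i ω) (fun i => Y n i ω))
        atTop (id : ℝ → ℝ) P (ν : Measure ℝ) ∧
      (∀ t : ℝ, cdf (ν : Measure ℝ) t = leftLimitCDF ℓ t) ∧
      (∀ t : ℝ, Tendsto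
        (fun n => (P n).real {ω |
          maxRankedQuotient (leftIndices n ℓ) (fun i => X n i ω) (fun i => Y n i ω) ≤ t})
        atTop (𝓝 (leftLimitCDF ℓ t))) := by
  have hlim := tendsto_measureReal_maxRankedQuotient_le hX hY hXY hℓ
  -- Monotonicity is inherited from the distribution functions of finite samples, with no need for
  -- the explicit formula.
  have hmono : Monotone (leftLimitCDF ℓ) := fun s t hst =>
    le_of_tendsto_of_tendsto' (hlim s) (hlim t) fun n =>
      measureReal_mono fun ω (hω : _ ≤ s) => le_trans hω hst
  obtain ⟨ν, hν, hcdf⟩ := exists_probabilityMeasure_cdf_eq hmono (continuous_leftLimitCDF hℓ)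
    (tendsto_leftLimitCDF_atBot ℓ) (tendsto_leftLimitCDF_atTop hℓ)
  have hmeas (n : ℕ) := aemeasurable_maxRankedQuotient (fun i => (hX n i).aemeasurable)
    (fun i => (hY n i).aemeasurable) (leftIndices n ℓ)
  refine ⟨ν, hν, tendstoInDistribution_of_tendsto_measureReal_le hmeas fun t => ?_, hcdf, hlim⟩
  rw [hcdf t]
  exact hlim t
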